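/- Let $\Sigma$ be an alphabet and let $R,S,R_i$ range over a set of symbols (variables). Expressions are $\gamma ::= \phi \mid \varepsilon \mid x \mid \gamma+\gamma \mid \gamma\cdot\gamma \mid \gamma^* \mid R$ with $x\in\Sigma$; regular expressions $r,s$ are the expressions without symbols $R$. A set of regular equations $\mathcal E=\{R_1\approx\alpha_1,\dots,R_n\approx\alpha_n\}$ has pairwise distinct left-hand sides, right-hand sides of the shape $\alpha ::= r\cdot R \mid r \mid \alpha+\alpha$, and every symbol on a right-hand side belongs to $\mathrm{dom}(\mathcal E)=\{R_1,\dots,R_n\}$. It is non-overlapping if each equation has the form $R\approx x_1\cdot S_1+\dots+x_k\cdot S_k+t$ ($k\ge 0$, $+$ right-associative) with pairwise distinct $x_i\in\Sigma$ and $t\in\{\varepsilon,\phi\}$. Let $\simeq$ be the smallest equivalence relation on expressions that is closed under sum contexts ($\gamma_1\simeq\gamma_2$ implies $\gamma_1+\beta\simeq\gamma_2+\beta$ and $\beta+\gamma_1\simeq\beta+\gamma_2$) and satisfies $\gamma_1(\gamma_2+\gamma_3)\simeq\gamma_1\gamma_2+\gamma_1\gamma_3$, $\gamma_1(\gamma_2\gamma_3)\simeq(\gamma_1\gamma_2)\gamma_3$,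 $\gamma_1+(\gamma_2+\gamma_3)\simeq(\gamma_1+\gamma_2)+\gamma_3$, $\gamma_2\gamma_1+\gamma_3\gamma_1\simeq(\gamma_2+\gamma_3)\gamma_1$, $\gamma_1+\gamma_2\simeq\gamma_2+\gamma_1$. Solving steps act on pairs $\langle\psi,\mathcal E\rangle$ of a substitution and a set of equations (right-hand sides may now be arbitrary expressions): - (Arden) if $R$ does not occur in $\alpha$ and $s$ is a regular expression, $\langle\psi,\{R\approx s\cdot R+\alpha\}\uplus\mathcal E\rangle\Rightarrow\langle\psi,\{R\approx s^*\cdot\alpha\}\uplus\mathcal E\rangle$; - (Subst) if $R$ does not occur in $\alpha$, $\langle\psi,\{R\approx\alpha\}\uplus\mathcal E\rangle\Rightarrow\langle\psi',\mathcal E'\rangle$, where $\psi'=\{R\mapsto\alpha\}\cup\{S\mapsto\{R\mapsto\alpha\}(\gamma) : (S\mapsto\gamma)\in\psi\}$ and $\mathcal E'$ has, for each equation $R'\approx\alpha'$ of $\mathcal E$, exactly one equation $R'\approx\alpha''$, for some $\alpha''\simeq\{R\mapsto\alpha\}(\alpha')$. Let $\Rightarrow^*$ be the reflexive transitive closure of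 $\Rightarrow$. Parse trees are $v ::= \mathrm{Eps}\mid\mathrm{Sym}\,x\mid\mathrm{Seq}\,v\,v\mid\mathrm{Inl}\,v\mid\mathrm{Inr}\,v\mid[\,]\mid v:v\mid\mathrm{Fold}\,v$, and $\mathcal E\vdash v:\gamma$ is defined inductively by: $\mathrm{Eps}:\varepsilon$; $\mathrm{Sym}\,x:x$; $[\,]:\gamma^*$; $(v:vs):\gamma^*$ if $v:\gamma$ and $vs:\gamma^*$; $\mathrm{Seq}\,v_1v_2:\gamma_1\cdot\gamma_2$ if $v_1:\gamma_1$ and $v_2:\gamma_2$; $\mathrm{Inl}\,v:\gamma_1+\gamma_2$ if $v:\gamma_1$; $\mathrm{Inr}\,v:\gamma_1+\gamma_2$ if $v:\gamma_2$; $\mathrm{Fold}\,v:R$ if $v:\alpha$ and $(R\approx\alpha)\in\mathcal E$. The word $|v|$ of $v$ is obtained by concatenating its letters from left to right. A regular expression $r$ is unambiguous if there are no two distinct parse trees $v_1\neq v_2$ with $\{\}\vdash v_1:r$, $\{\}\vdash v_2:r$ and $|v_1|=|v_2|$. **Theorem (Unambiguous Solutions).** Let $\mathcal E$ be a non-overlapping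 set of regular equations, and let $\mathcal E_0$ be $\mathcal E$ itself or, more generally, any set obtained from $\mathcal E$ by replacing each right-hand side $\alpha$ by some $\alpha_0\simeq\alpha$ (for instance a normal form). If $\langle\{\},\mathcal E_0\rangle\Rightarrow^*\langle\psi,\{\}\rangle$, then for each $R\in\mathrm{dom}(\mathcal E)$, $\psi(R)$ is defined and is an unambiguous regular expression. -/

import Mathlib

universe u v

namespace RegEq

/-- Expressions `γ` mixing regular expressions over the alphabet `A` with regular language
symbols (variables) taken from `V`. -/
inductive Exp (A : Type u) (V : Type v) : Type (max u v)
  | zero : Exp A V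
  | eps : Exp A V
  | sym (x : A) : Exp A V
  | plus (γ₁ γ₂ : Exp A V) : Exp A V
  | comp (γ₁ γ₂ : Exp A V) : Exp A V
  | star (γ : Exp A V) : Exp A V
  | var (R : V) : Exp A V

namespace Exp

variable {A : Type u} {V : Type v}

/-- A regular expression, seen as an expression in which no symbol `R` appears. -/
def ofRE : RegularExpression A → Exp A V
  | .zero => zero
  | .epsilon => eps
  | .char x => sym x
  | .plus r s => plus (ofRE r) (ofRE s)
  | .comp r s => comp (ofRE r) (ofRE s)
  | .star r => star (ofRE r)

/-- `Occurs R γ`: the symbol `R` appears in `γ`. -/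
def Occurs (R : V) : Exp A V → Prop
  | zero => False
  | eps => False
  | sym _ => False
  | plus γ₁ γ₂ => Occurs R γ₁ ∨ Occurs R γ₂
  | comp γ₁ γ₂ => Occurs R γ₁ ∨ Occurs R γ₂
  | star γ => Occurs R γ
  | var S => S = R

/-- `replace R α γ` is `{R ↦ α}(γ)`: each occurrence of `R` in `γ` is replaced by `α`. -/
def replace [DecidableEq V] (R : V) (α : Exp A V) : Exp A V → Exp A V
  | zero => zero
  | eps => eps
  | sym x => sym x
  | plus γ₁ γ₂ => plus (replace R α γ₁) (replace R α γ₂)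
  | comp γ₁ γ₂ => comp (replace R α γ₁) (replace R α γ₂)
  | star γ => star (replace R α γ)
  | var S => if S = R then α else var S

/-- The right-hand sides `α ::= r · R | r | α + α` of regular equations. -/
inductive IsRhs : Exp A V → Prop
  | comp (r : RegularExpression A) (R : V) : IsRhs (comp (ofRE r) (var R))
  | re (r : RegularExpression A) : IsRhs (ofRE r)
  | plus {α β : Exp A V} : IsRhs α → IsRhs β → IsRhs (plus α β)

/-- The equivalence `γ₁ ≃ γ₂` generated by the algebraic laws. The last two rules close it under
sum contexts `β[] ::= [] | β[] + β | β + β[]`. -/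
inductive Eqv : Exp A V → Exp A V → Prop
  | distrib_left (γ₁ γ₂ γ₃ : Exp A V) :
      Eqv (comp γ₁ (plus γ₂ γ₃)) (plus (comp γ₁ γ₂) (comp γ₁ γ₃))
  | comp_assoc (γ₁ γ₂ γ₃ : Exp A V) :
      Eqv (comp γ₁ (comp γ₂ γ₃)) (comp (comp γ₁ γ₂) γ₃)
  | plus_assoc (γ₁ γ₂ γ₃ : Exp A V) :
      Eqv (plus γ₁ (plus γ₂ γ₃)) (plus (plus γ₁ γ₂) γ₃)
  | distrib_right (γ₁ γ₂ γ₃ : Exp A V) :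
      Eqv (plus (comp γ₂ γ₁) (comp γ₃ γ₁)) (comp (plus γ₂ γ₃) γ₁)
  | plus_comm (γ₁ γ₂ : Exp A V) : Eqv (plus γ₁ γ₂) (plus γ₂ γ₁)
  | refl (γ : Exp A V) : Eqv γ γ
  | symm {γ₁ γ₂ : Exp A V} : Eqv γ₁ γ₂ → Eqv γ₂ γ₁
  | trans {γ₁ γ₂ γ₃ : Exp A V} : Eqv γ₁ γ₂ → Eqv γ₂ γ₃ → Eqv γ₁ γ₃
  | plus_left {γ₁ γ₂ : Exp A V} (β : Exp A V) : Eqv γ₁ γ₂ → Eqv (plus γ₁ β) (plus γ₂ β)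
  | plus_right {γ₁ γ₂ : Exp A V} (β : Exp A V) : Eqv γ₁ γ₂ → Eqv (plus β γ₁) (plus β γ₂)

/-- The right-associated sum `x₁ · R₁ + (x₂ · R₂ + (⋯ + (xₙ · Rₙ + t)))`. -/
def linearSum (l : List (A × V)) (t : Exp A V) : Exp A V :=
  l.foldr (fun p α => plus (comp (sym p.1) (var p.2)) α) t

end Exp

/-- A partial map from symbols to expressions. It serves both as a set of equations
`{R₁ ≈ α₁, …, Rₙ ≈ αₙ}` with distinct left-hand sides and as a substitution
`{R₁ ↦ γ₁, …, Rₙ ↦ γₙ}`. -/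
abbrev PMap (A : Type u) (V : Type v) : Type (max u v) := V → Option (Exp A V)

namespace PMap

variable {A : Type u} {V : Type v}

/-- The empty set of equations, respectively the empty substitution. -/
def empty : PMap A V := fun _ => none

/-- The set of symbols `R` having an equation `R ≈ α`, respectively an entry `R ↦ γ`. -/
def dom (E : PMap A V) : Set V := {R | (E R).isSome}

end PMap

section Equations

variable {A : Type u} {V : Type v}

/-- `E` is a (finite) set of regular equations: right-hand sides have the required shape, and
every symbol on a right-hand side is the left-hand side of some equation. -/
structure IsRegularEquations (E : PMap A V) : Prop where
  finite : E.dom.Finite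
  rhs : ∀ R α, E R = some α → α.IsRhs
  closed : ∀ R α, E R = some α → ∀ S, α.Occurs S → S ∈ E.dom

/-- All equations of `E` have the form `R ≈ x₁ · R₁ + ⋯ + xₙ · Rₙ + t` with pairwise distinct
alphabet symbols `xᵢ` and `t = ε` or `t = φ`. -/
def NonOverlapping (E : PMap A V) : Prop :=
  ∀ R α, E R = some α → ∃ (l : List (A × V)) (t : Exp A V),
    (l.map Prod.fst).Nodup ∧ (t = Exp.eps ∨ t = Exp.zero) ∧ α = Exp.linearSum l t

/-- `E'` arises from `E` by rewriting each right-hand side into an equivalent expression. -/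
def Normalizes (E E' : PMap A V) : Prop :=
  ∀ S, Option.Rel Exp.Eqv (E S) (E' S)

/-- Solving steps `⟨ψ, E⟩ ⇒ ⟨ψ', E'⟩`. -/
inductive Step [DecidableEq V] : PMap A V × PMap A V → PMap A V × PMap A V → Prop
  | arden (ψ E : PMap A V) (R : V) (s : RegularExpression A) (α : Exp A V) :
      E R = some (.plus (.comp (Exp.ofRE s) (.var R)) α) → ¬ α.Occurs R →
      Step (ψ, E) (ψ, Function.update E R (some (.comp (.star (Exp.ofRE s)) α)))
  | subst (ψ E E' : PMap A V) (R : V) (α : Exp A V) :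
      E R = some α → ¬ α.Occurs R →
      Normalizes (Function.update (fun S => (E S).map (Exp.replace R α)) R none) E' →
      Step (ψ, E) (Function.update (fun S => (ψ S).map (Exp.replace R α)) R (some α), E')

/-- `⟨ψ, E⟩ ⇒* ⟨ψ', E'⟩`. -/
def Steps [DecidableEq V] : PMap A V × PMap A V → PMap A V × PMap A V → Prop :=
  Relation.ReflTransGen Step

end Equations

/-- Parse trees. The lists `vs ::= [] | v : vs` are built by `nil` and `cons`; only genuine lists
are ever valid for a starred expression. -/
inductive Tree (A : Type u) : Type u
  | eps : Tree A
  | sym (x : A) : Tree A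
  | seq (v₁ v₂ : Tree A) : Tree A
  | inl (v : Tree A) : Tree A
  | inr (v : Tree A) : Tree A
  | nil : Tree A
  | cons (v vs : Tree A) : Tree A
  | fold (v : Tree A) : Tree A

/-- The word underlying a parse tree. -/
def Tree.flatten {A : Type u} : Tree A → List A
  | .eps => []
  | .sym x => [x]
  | .seq v₁ v₂ => v₁.flatten ++ v₂.flatten
  | .inl v => v.flatten
  | .inr v => v.flatten
  | .nil => []
  | .cons v vs => v.flatten ++ vs.flatten
  | .fold v => v.flatten

section Trees

variable {A : Type u} {V : Type v}

/-- `HasTree E v γ` is the judgement `E ⊢ v : γ`. -/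
inductive HasTree (E : PMap A V) : Tree A → Exp A V → Prop
  | nil (γ : Exp A V) : HasTree E .nil (.star γ)
  | cons {v vs : Tree A} {γ : Exp A V} :
      HasTree E v γ → HasTree E vs (.star γ) → HasTree E (.cons v vs) (.star γ)
  | eps : HasTree E .eps .eps
  | sym (x : A) : HasTree E (.sym x) (.sym x)
  | seq {v₁ v₂ : Tree A} {γ₁ γ₂ : Exp A V} :
      HasTree E v₁ γ₁ → HasTree E v₂ γ₂ → HasTree E (.seq v₁ v₂) (.comp γ₁ γ₂)
  | inl {v : Tree A} {γ₁ γ₂ : Exp A V} : HasTree E v γ₁ → HasTree E (.inl v) (.plus γ₁ γ₂)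
  | inr {v : Tree A} {γ₁ γ₂ : Exp A V} : HasTree E v γ₂ → HasTree E (.inr v) (.plus γ₁ γ₂)
  | fold {v : Tree A} {R : V} {α : Exp A V} :
      HasTree E v α → E R = some α → HasTree E (.fold v) (.var R)

/-- `γ` is ambiguous w.r.t. `E`: two distinct parse trees share the same underlying word. -/
def Ambiguous (E : PMap A V) (γ : Exp A V) : Prop :=
  ∃ v₁ v₂ : Tree A, v₁ ≠ v₂ ∧ HasTree E v₁ γ ∧ HasTree E v₂ γ ∧ v₁.flatten = v₂.flatten

end Trees

end RegEq

/-! Read an expression as a formal power series over ℕ∞ whose coefficient at a word bounds from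
below, up to two, the number of its parse trees (`countsTrees_series`). A closed expression all of
whose coefficients are at most 1 is then unambiguous. Coefficients in ℕ∞ are needed because starring
a series with nonzero constant term gives infinite multiplicities.

A non-overlapping system is a deterministic automaton. Its 0/1-valued acceptance series satisfy
every equation as an inequality, right-hand side below left-hand side (`NonOverlapping.series_le`).
Solving preserves these inequalities: the laws of `≃` are semiring identities, without idempotence
of `+`, so they keep multiplicities; Arden's rule picks a lower bound for all presolutions
(`starSeries_conv_le`); substitution is monotone (`series_replace_le`). Inequalities suffice and are
stable where equalities need not be: `X = X + g` has many solutions. When no equation is left,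
`ψ(R)` is symbol-free and its series lies below acceptance from `R`, hence below 1. -/

namespace RegEq

variable {A : Type u} {V : Type v}

/-! ### Formal power series with coefficients in `ℕ∞` -/

/-- The Cauchy product of two formal power series. -/
def conv (f g : List A → ℕ∞) : List A → ℕ∞
  | [] => f [] * g []
  | x :: w => f [] * g (x :: w) + conv (fun u => f (x :: u)) g w

theorem conv_nil (f g : List A → ℕ∞) : conv f g [] = f [] * g [] := by
  rw [conv]

theorem conv_cons (f g : List A → ℕ∞) (x : A) (w : List A) :
    conv f g (x :: w) = f [] * g (x :: w) + conv (fun u => f (x :: u)) g w := by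
  rw [conv]

theorem zero_conv (f : List A → ℕ∞) (w : List A) : conv (fun _ => 0) f w = 0 := by
  induction w with
  | nil => simp [conv_nil]
  | cons x w ih => simp [conv_cons, ih]

theorem add_conv (f g h : List A → ℕ∞) : conv (f + g) h = conv f h + conv g h := by
  funext w
  induction w generalizing f g with
  | nil => simp [conv_nil, add_mul]
  | cons x w ih =>
    have := ih (fun u => f (x :: u)) (fun u => g (x :: u))
    simp only [Pi.add_def, conv_cons] at this ⊢
    rw [this, add_mul]
    abel

theorem conv_add (f g h : List A → ℕ∞) : conv f (g + h) = conv f g + conv f h := by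
  funext w
  induction w generalizing f with
  | nil => simp [conv_nil, mul_add]
  | cons x w ih =>
    have := ih (fun u => f (x :: u))
    simp only [Pi.add_def, conv_cons] at this ⊢
    rw [this, mul_add]
    abel

theorem smul_conv (c : ℕ∞) (f g : List A → ℕ∞) :
    conv (fun u => c * f u) g = fun w => c * conv f g w := by
  funext w
  induction w generalizing f with
  | nil => simp [conv_nil, mul_assoc]
  | cons x w ih => simp [conv_cons, ih, mul_add, mul_assoc]

theorem conv_assoc (f g h : List A → ℕ∞) : conv (conv f g) h = conv f (conv g h) := by
  funext w
  induction w generalizing f with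
  | nil => simp [conv_nil, mul_assoc]
  | cons x w ih =>
    have h₁ : (fun u => conv f g (x :: u)) =
        (fun u => f [] * g (x :: u)) + conv (fun u => f (x :: u)) g := by
      funext u
      simp [conv_cons]
    rw [conv_cons, h₁, add_conv, Pi.add_apply, ih, smul_conv, conv_cons, conv_cons, conv_nil,
      mul_add, mul_assoc, add_assoc]

theorem conv_mono {f f' g g' : List A → ℕ∞} (hf : f ≤ f') (hg : g ≤ g') :
    conv f g ≤ conv f' g' := by
  intro w
  induction w generalizing f f' with
  | nil =>
    rw [conv_nil, conv_nil]
    exact mul_le_mul' (hf _) (hg _)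
  | cons x w ih =>
    rw [conv_cons, conv_cons]
    exact add_le_add (mul_le_mul' (hf _) (hg _)) (ih fun u => hf (x :: u))

/-- Each coefficient is a finite sum of products. Multiplication by a constant commutes with suprema
in ℕ∞; addition of two suprema over the same index does so because both families increase. -/
theorem conv_iSup (f : List A → ℕ∞) {g : ℕ → List A → ℕ∞} (hg : Monotone g) :
    conv f (⨆ n, g n) = ⨆ n, conv f (g n) := by
  funext w
  rw [iSup_apply]
  induction w generalizing f with
  | nil => simp [conv_nil, iSup_apply, ENat.mul_iSup]
  | cons x w ih =>
    simp only [conv_cons, ih, iSup_apply, ENat.mul_iSup]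
    refine ENat.iSup_add_iSup_of_monotone (fun m n h => ?_) (fun m n h => ?_)
    · exact mul_le_mul' le_rfl (hg h _)
    · exact conv_mono le_rfl (hg h) _

theorem iSup_conv {f : ℕ → List A → ℕ∞} (g : List A → ℕ∞) (hf : Monotone f) :
    conv (⨆ n, f n) g = ⨆ n, conv (f n) g := by
  funext w
  rw [iSup_apply]
  induction w generalizing f with
  | nil => simp [conv_nil, iSup_apply, ENat.iSup_mul]
  | cons x w ih =>
    have hf' : Monotone fun n u => f n (x :: u) := fun m n h u => hf h _
    have h₁ : (fun u => (⨆ n, f n) (x :: u)) = ⨆ n, fun u => f n (x :: u) := by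
      funext u
      simp [iSup_apply]
    simp only [conv_cons]
    rw [h₁, ih hf', iSup_apply, ENat.iSup_mul]
    refine ENat.iSup_add_iSup_of_monotone (fun m n h => ?_) (fun m n h => ?_)
    · exact mul_le_mul' (hf h _) le_rfl
    · exact conv_mono (hf' h) le_rfl _

theorem mul_le_conv (f g : List A → ℕ∞) (u z : List A) : f u * g z ≤ conv f g (u ++ z) := by
  induction u generalizing f with
  | nil =>
    cases z with
    | nil => rw [List.append_nil, conv_nil]
    | cons x z =>
      rw [List.nil_append, conv_cons]
      exact le_self_add
  | cons x u ih =>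
    rw [List.cons_append, conv_cons]
    exact (ih fun u => f (x :: u)).trans le_add_self

/-- Two different factorizations of one word are two different summands of the Cauchy product. -/
theorem mul_add_mul_le_conv (f g : List A → ℕ∞) {u₁ u₂ z₁ z₂ : List A} (hne : u₁ ≠ u₂)
    (h : u₁ ++ z₁ = u₂ ++ z₂) : f u₁ * g z₁ + f u₂ * g z₂ ≤ conv f g (u₁ ++ z₁) := by
  induction u₁ generalizing u₂ f with
  | nil =>
    cases u₂ with
    | nil => exact absurd rfl hne
    | cons x u₂ =>
      simp only [List.nil_append, List.cons_append] at h
      subst h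
      rw [List.nil_append, conv_cons]
      exact add_le_add le_rfl (mul_le_conv (fun u => f (x :: u)) g u₂ z₂)
  | cons x u₁ ih =>
    cases u₂ with
    | nil =>
      simp only [List.nil_append, List.cons_append] at h
      subst h
      rw [List.cons_append, conv_cons, add_comm]
      exact add_le_add le_rfl (mul_le_conv (fun u => f (x :: u)) g u₁ z₁)
    | cons y u₂ =>
      simp only [List.cons_append, List.cons.injEq] at h
      obtain ⟨rfl, h⟩ := h
      rw [List.cons_append, conv_cons]
      refine (ih (fun u => f (x :: u)) (fun e => hne (by rw [e])) h).trans le_add_self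

/-- The series with constant coefficient `1` and all other coefficients `0`. -/
def oneSeries : List A → ℕ∞
  | [] => 1
  | _ :: _ => 0

theorem one_conv (f : List A → ℕ∞) : conv oneSeries f = f := by
  funext w
  cases w with
  | nil => simp [conv_nil, oneSeries]
  | cons x w => simp [conv_cons, oneSeries, zero_conv]

/-- The partial sums `1 + f + ⋯ + fⁿ⁻¹` in Horner form. -/
def starApprox (f : List A → ℕ∞) : ℕ → List A → ℕ∞
  | 0 => 0
  | n + 1 => oneSeries + conv f (starApprox f n)

theorem starApprox_monotone (f : List A → ℕ∞) : Monotone (starApprox f) := by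
  refine monotone_nat_of_le_succ fun n => ?_
  induction n with
  | zero => exact fun _ => zero_le
  | succ n ih => exact add_le_add le_rfl (conv_mono le_rfl ih)

/-- The Kleene star `1 + f + f² + ⋯` of a series. -/
noncomputable def starSeries (f : List A → ℕ∞) : List A → ℕ∞ := ⨆ n, starApprox f n

/-- This half of the fixed-point equation is the one that bounds multiplicities of star trees from
below: the summand `oneSeries` accounts for the empty list, the product for nonempty lists. -/
theorem starSeries_unfold_le (f : List A → ℕ∞) :
    oneSeries + conv f (starSeries f) ≤ starSeries f := by
  intro w
  rw [starSeries, conv_iSup f (starApprox_monotone f), Pi.add_apply, iSup_apply, ENat.add_iSup]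
  refine iSup_le fun n => ?_
  rw [iSup_apply]
  exact le_iSup (fun n => starApprox f n w) (n + 1)

theorem starSeries_mono {f g : List A → ℕ∞} (h : f ≤ g) : starSeries f ≤ starSeries g := by
  refine iSup_mono fun n => ?_
  induction n with
  | zero => exact le_rfl
  | succ n ih => exact add_le_add le_rfl (conv_mono h ih)

/-- Arden's rule for presolutions. -/
theorem starSeries_conv_le {f g X : List A → ℕ∞} (h : conv f X + g ≤ X) :
    conv (starSeries f) g ≤ X := by
  rw [starSeries, iSup_conv g (starApprox_monotone f)]
  refine iSup_le fun n => ?_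
  induction n with
  | zero =>
    intro w
    exact (zero_conv g w).le.trans zero_le
  | succ n ih =>
    rw [starApprox, add_conv, one_conv, conv_assoc, add_comm]
    exact (add_le_add (conv_mono le_rfl ih) le_rfl).trans h

/-! ### The series of an expression -/

namespace Exp

/-- The series of an expression, relative to a valuation of its symbols. -/
noncomputable def series (ρ : V → List A → ℕ∞) : Exp A V → List A → ℕ∞
  | zero => 0
  | eps => oneSeries
  | sym x => open Classical in fun w => if w = [x] then 1 else 0
  | plus γ₁ γ₂ => series ρ γ₁ + series ρ γ₂
  | comp γ₁ γ₂ => conv (series ρ γ₁) (series ρ γ₂)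
  | star γ => starSeries (series ρ γ)
  | var R => ρ R

/-- Every generating law is a semiring identity, so multiplicities are preserved exactly and not
only languages. -/
theorem Eqv.series_eq {γ₁ γ₂ : Exp A V} (h : Eqv γ₁ γ₂) (ρ : V → List A → ℕ∞) :
    γ₁.series ρ = γ₂.series ρ := by
  induction h with
  | distrib_left => exact conv_add _ _ _
  | comp_assoc => exact (conv_assoc _ _ _).symm
  | plus_assoc => exact (add_assoc _ _ _).symm
  | distrib_right => exact (add_conv _ _ _).symm
  | plus_comm => exact add_comm _ _
  | refl => rfl
  | symm _ ih => exact ih.symm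
  | trans _ _ ih₁ ih₂ => exact ih₁.trans ih₂
  | plus_left β _ ih => exact congrArg (· + β.series ρ) ih
  | plus_right β _ ih => exact congrArg (β.series ρ + ·) ih

theorem Eqv.occurs_iff {γ₁ γ₂ : Exp A V} (h : Eqv γ₁ γ₂) (R : V) :
    γ₁.Occurs R ↔ γ₂.Occurs R := by
  induction h with
  | refl => rfl
  | symm _ ih => exact ih.symm
  | trans _ _ ih₁ ih₂ => exact ih₁.trans ih₂
  | plus_left β _ ih => exact or_congr_left ih
  | plus_right β _ ih => exact or_congr_right ih
  | _ => simp only [Occurs]; tauto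

theorem series_replace_le [DecidableEq V] {ρ : V → List A → ℕ∞} {R : V} {α : Exp A V}
    (h : α.series ρ ≤ ρ R) (γ : Exp A V) : (replace R α γ).series ρ ≤ γ.series ρ := by
  induction γ with
  | zero => exact le_rfl
  | eps => exact le_rfl
  | sym x => exact le_rfl
  | plus γ₁ γ₂ ih₁ ih₂ => exact add_le_add ih₁ ih₂
  | comp γ₁ γ₂ ih₁ ih₂ => exact conv_mono ih₁ ih₂
  | star γ ih => exact starSeries_mono ih
  | var S =>
    rw [replace]
    split_ifs with hS
    · exact hS ▸ h
    · exact le_rfl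

theorem Occurs.of_replace [DecidableEq V] {R S : V} {α γ : Exp A V}
    (h : (replace R α γ).Occurs S) : α.Occurs S ∨ (γ.Occurs S ∧ S ≠ R) := by
  induction γ with
  | zero => exact h.elim
  | eps => exact h.elim
  | sym x => exact h.elim
  | plus γ₁ γ₂ ih₁ ih₂ =>
    exact h.elim (fun h => (ih₁ h).imp_right (And.imp_left Or.inl))
      (fun h => (ih₂ h).imp_right (And.imp_left Or.inr))
  | comp γ₁ γ₂ ih₁ ih₂ =>
    exact h.elim (fun h => (ih₁ h).imp_right (And.imp_left Or.inl))
      (fun h => (ih₂ h).imp_right (And.imp_left Or.inr))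
  | star γ ih => exact ih h
  | var T =>
    rw [replace] at h
    split_ifs at h with hT
    · exact Or.inl h
    · exact Or.inr ⟨h, fun e => hT (Eq.trans h e)⟩

theorem not_occurs_ofRE (r : RegularExpression A) (S : V) : ¬ (ofRE r : Exp A V).Occurs S := by
  induction r with
  | zero => exact id
  | epsilon => exact id
  | char x => exact id
  | plus r s ih₁ ih₂ => exact fun h => h.elim ih₁ ih₂
  | comp r s ih₁ ih₂ => exact fun h => h.elim ih₁ ih₂
  | star r ih => exact ih

theorem exists_eq_ofRE {γ : Exp A V} (h : ∀ S, ¬ γ.Occurs S) :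
    ∃ r : RegularExpression A, γ = ofRE r := by
  induction γ with
  | zero => exact ⟨.zero, rfl⟩
  | eps => exact ⟨.epsilon, rfl⟩
  | sym x => exact ⟨.char x, rfl⟩
  | plus γ₁ γ₂ ih₁ ih₂ =>
    obtain ⟨r, rfl⟩ := ih₁ fun S hS => h S (Or.inl hS)
    obtain ⟨s, rfl⟩ := ih₂ fun S hS => h S (Or.inr hS)
    exact ⟨.plus r s, rfl⟩
  | comp γ₁ γ₂ ih₁ ih₂ =>
    obtain ⟨r, rfl⟩ := ih₁ fun S hS => h S (Or.inl hS)
    obtain ⟨s, rfl⟩ := ih₂ fun S hS => h S (Or.inr hS)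
    exact ⟨.comp r s, rfl⟩
  | star γ ih =>
    obtain ⟨r, rfl⟩ := ih h
    exact ⟨.star r, rfl⟩
  | var S => exact absurd rfl (h S)

end Exp

/-! ### Counting parse trees -/

/-- The series `f` detects the first two trees among those satisfying `P` on every word. -/
structure CountsTrees (P : Tree A → Prop) (f : List A → ℕ∞) : Prop where
  one_le : ∀ v, P v → 1 ≤ f v.flatten
  two_le : ∀ v₁ v₂, v₁ ≠ v₂ → P v₁ → P v₂ → v₁.flatten = v₂.flatten → 2 ≤ f v₁.flatten

/-- Shared by concatenation and star. If both pairs split the word at the same place, one factor is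
at least 2 and the other at least 1; otherwise two summands of the product are each at least 1. The
second factor is constrained only at `z₁` and `z₂`, so that for star the induction hypothesis on the
tail is enough. -/
theorem CountsTrees.two_le_conv {P : Tree A → Prop} {f g : List A → ℕ∞} (hf : CountsTrees P f)
    {v₁ v₂ z₁ z₂ : Tree A} (hv₁ : P v₁) (hv₂ : P v₂) (hz₁ : 1 ≤ g z₁.flatten)
    (hz₂ : 1 ≤ g z₂.flatten)
    (hz : z₁ ≠ z₂ → z₁.flatten = z₂.flatten → 2 ≤ g z₁.flatten)
    (hne : v₁ ≠ v₂ ∨ z₁ ≠ z₂)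
    (h : v₁.flatten ++ z₁.flatten = v₂.flatten ++ z₂.flatten) :
    2 ≤ conv f g (v₁.flatten ++ z₁.flatten) := by
  by_cases hw : v₁.flatten = v₂.flatten
  · have hw' : z₁.flatten = z₂.flatten := by
      rw [hw] at h
      exact List.append_cancel_left h
    refine le_trans ?_ (mul_le_conv f g _ _)
    by_cases hv : v₁ = v₂
    · simpa using mul_le_mul' (hf.one_le v₁ hv₁) (hz (hne.resolve_left (not_not.2 hv)) hw')
    · simpa using mul_le_mul' (hf.two_le v₁ v₂ hv hv₁ hv₂ hw) hz₁
  · refine le_trans ?_ (mul_add_mul_le_conv f g hw h)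
    have := add_le_add (mul_le_mul' (hf.one_le v₁ hv₁) hz₁) (mul_le_mul' (hf.one_le v₂ hv₂) hz₂)
    simpa [one_add_one_eq_two] using this

theorem countsTrees_star {γ : Exp A V} {f : List A → ℕ∞}
    (hf : CountsTrees (fun v => HasTree PMap.empty v γ) f) :
    CountsTrees (fun v => HasTree PMap.empty v γ.star) (starSeries f) := by
  have hle : conv f (starSeries f) ≤ starSeries f :=
    le_trans (fun _ => le_add_self) (starSeries_unfold_le f)
  have hone : ∀ v, HasTree PMap.empty v γ.star → 1 ≤ starSeries f v.flatten := by
    intro v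
    induction v with
    | nil =>
      intro _
      refine le_trans ?_ (starSeries_unfold_le f _)
      exact le_self_add
    | cons v vs _ ih =>
      intro h
      cases h with
      | cons hv hvs =>
        refine le_trans ?_ ((mul_le_conv f _ _ _).trans (hle _))
        simpa using mul_le_mul' (hf.one_le v hv) (ih hvs)
    | _ => exact fun h => nomatch h
  -- A nonempty list over the empty word competes with `nil`: one unit comes from `oneSeries`, a
  -- second from the product.
  have hmixed : ∀ v vs, HasTree PMap.empty v γ → HasTree PMap.empty vs γ.star →
      v.flatten ++ vs.flatten = [] → 2 ≤ starSeries f [] := by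
    intro v vs hv hvs h
    refine le_trans ?_ (starSeries_unfold_le f [])
    have h₁ := mul_le_mul' (hf.one_le v hv) (hone vs hvs)
    have h₂ := add_le_add (le_refl (1 : ℕ∞)) (h₁.trans (mul_le_conv f (starSeries f) _ _))
    rw [h, one_mul, one_add_one_eq_two] at h₂
    exact h₂
  refine ⟨hone, ?_⟩
  intro v₁
  induction v₁ with
  | nil =>
    intro v₂ hne _ h₂ hw
    cases h₂ with
    | nil => exact absurd rfl hne
    | cons hv hvs => exact hmixed _ _ hv hvs hw.symm
  | cons v vs _ ih =>
    intro v₂ hne h₁ h₂ hw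
    cases h₁ with
    | cons hv hvs =>
      cases h₂ with
      | nil =>
        have := hmixed _ _ hv hvs hw
        rwa [hw]
      | @cons v' vs' _ hv' hvs' =>
        refine le_trans ?_ (hle _)
        refine hf.two_le_conv hv hv' (hone _ hvs) (hone _ hvs')
          (fun hne' hw' => ih vs' hne' hvs hvs' hw') ?_ hw
        by_contra! hcon
        exact hne (by rw [hcon.1, hcon.2])
  | _ => exact fun _ _ h => nomatch h

/-- The valuation is arbitrary because, with no equations, a symbol has no parse tree to count. -/
theorem countsTrees_series (ρ : V → List A → ℕ∞) (γ : Exp A V) :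
    CountsTrees (fun v => HasTree PMap.empty v γ) (γ.series ρ) := by
  induction γ with
  | zero => exact ⟨fun _ h => (nomatch h), fun _ _ _ h => (nomatch h)⟩
  | eps =>
    constructor
    · rintro _ ⟨⟩
      exact le_rfl
    · rintro _ _ hne ⟨⟩ ⟨⟩
      exact absurd rfl hne
  | sym x =>
    constructor
    · rintro _ ⟨⟩
      simp [Exp.series, Tree.flatten]
    · rintro _ _ hne ⟨⟩ ⟨⟩
      exact absurd rfl hne
  | plus γ₁ γ₂ ih₁ ih₂ =>
    constructor
    · intro v h
      cases h with
      | inl h => exact (ih₁.one_le _ h).trans le_self_add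
      | inr h => exact (ih₂.one_le _ h).trans le_add_self
    · intro v₁ v₂ hne h₁ h₂ hw
      cases h₁ with
      | inl h₁ =>
        cases h₂ with
        | inl h₂ =>
          exact (ih₁.two_le _ _ (fun e => hne (by rw [e])) h₁ h₂ hw).trans le_self_add
        | inr h₂ =>
          have := add_le_add (ih₁.one_le _ h₁) (ih₂.one_le _ h₂)
          rw [one_add_one_eq_two] at this
          simp only [Tree.flatten] at hw
          rw [← hw] at this
          exact this
      | inr h₁ =>
        cases h₂ with
        | inl h₂ =>
          have := add_le_add (ih₁.one_le _ h₂) (ih₂.one_le _ h₁)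
          rw [one_add_one_eq_two] at this
          simp only [Tree.flatten] at hw
          rw [← hw] at this
          exact this
        | inr h₂ =>
          exact (ih₂.two_le _ _ (fun e => hne (by rw [e])) h₁ h₂ hw).trans le_add_self
  | comp γ₁ γ₂ ih₁ ih₂ =>
    constructor
    · intro v h
      cases h with
      | seq h₁ h₂ =>
        refine le_trans ?_ (mul_le_conv _ _ _ _)
        simpa using mul_le_mul' (ih₁.one_le _ h₁) (ih₂.one_le _ h₂)
    · intro v v' hne h h' hw
      cases h with
      | seq h₁ h₂ =>
        cases h' with
        | seq h₁' h₂' =>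
          refine ih₁.two_le_conv h₁ h₁' (ih₂.one_le _ h₂) (ih₂.one_le _ h₂')
            (fun hne' hw' => ih₂.two_le _ _ hne' h₂ h₂' hw') ?_ hw
          by_contra! hcon
          exact hne (by rw [hcon.1, hcon.2])
  | star γ ih => exact countsTrees_star ih
  | var R =>
    have hnone : ∀ v : Tree A, ¬ HasTree PMap.empty v (.var R) := by
      intro v h
      cases h with
      | fold _ h => exact nomatch h
    exact ⟨fun v h => absurd h (hnone v), fun v _ _ h => absurd h (hnone v)⟩

theorem not_ambiguous_of_series_le_one {ρ : V → List A → ℕ∞} {γ : Exp A V}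
    (h : ∀ w, γ.series ρ w ≤ 1) : ¬ Ambiguous PMap.empty γ := by
  rintro ⟨v₁, v₂, hne, h₁, h₂, hw⟩
  exact absurd (((countsTrees_series ρ γ).two_le v₁ v₂ hne h₁ h₂ hw).trans (h _)) (by decide)

/-! ### The deterministic valuation of a non-overlapping system -/

open Classical in
/-- The characteristic series of the words accepted from a symbol of a non-overlapping system. -/
noncomputable def acceptance (E : PMap A V) : List A → V → ℕ∞
  | [], S => if ∃ l, E S = some (Exp.linearSum l .eps) then 1 else 0
  | x :: w, S => ⨆ (T : V) (_ : ∃ l t, E S = some (Exp.linearSum l t) ∧ (x, T) ∈ l),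
      acceptance E w T

/-- Taking a supremum over successors instead of a sum gives the bound without determinism, which
enters only when sums are compared with this supremum. -/
theorem acceptance_le_one (E : PMap A V) (w : List A) (S : V) : acceptance E w S ≤ 1 := by
  induction w generalizing S with
  | nil =>
    rw [acceptance]
    split_ifs <;> simp
  | cons x w ih =>
    rw [acceptance]
    exact iSup₂_le fun T _ => ih T

theorem series_linearSum_nil (ρ : V → List A → ℕ∞) (l : List (A × V)) (t : Exp A V) :
    (Exp.linearSum l t).series ρ [] = t.series ρ [] := by
  induction l with
  | nil => rfl
  | cons p l ih =>
    have : (Exp.linearSum (p :: l) t).series ρ [] =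
        conv ((Exp.sym p.1).series ρ) (ρ p.2) [] + (Exp.linearSum l t).series ρ [] := rfl
    rw [this, ih, conv_nil]
    simp [Exp.series]

theorem series_sym_comp_cons (ρ : V → List A → ℕ∞) (x y : A) (S : V) (w : List A) :
    (Exp.comp (.sym y) (.var S)).series ρ (x :: w) = open Classical in
      if x = y then ρ S w else 0 := by
  simp only [Exp.series]
  rw [conv_cons]
  by_cases h : x = y
  · subst h
    have : (fun u : List A => open Classical in if u = [] then (1 : ℕ∞) else 0) = oneSeries := by
      funext u
      cases u <;> simp [oneSeries]
    simp only [List.cons.injEq, true_and, if_true]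
    rw [this, one_conv]
    simp
  · simp [h, zero_conv]

/-- Since the leading letters are distinct, at most one summand is nonzero on a word starting with
`x`, so the sum is bounded by a supremum. -/
theorem series_linearSum_cons_le (ρ : V → List A → ℕ∞) {t : Exp A V}
    (ht : t = .eps ∨ t = .zero) {l : List (A × V)} (hl : (l.map Prod.fst).Nodup) (x : A)
    (w : List A) :
    (Exp.linearSum l t).series ρ (x :: w) ≤ ⨆ (T : V) (_ : (x, T) ∈ l), ρ T w := by
  induction l with
  | nil =>
    have : (Exp.linearSum [] t).series ρ (x :: w) = 0 := by
      rcases ht with rfl | rfl <;> rfl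
    rw [this]
    exact zero_le
  | cons p l ih =>
    rw [List.map_cons, List.nodup_cons] at hl
    have h₁ : (Exp.linearSum (p :: l) t).series ρ (x :: w) =
        (Exp.comp (.sym p.1) (.var p.2)).series ρ (x :: w) +
          (Exp.linearSum l t).series ρ (x :: w) := rfl
    rw [h₁, series_sym_comp_cons]
    by_cases hx : x = p.1
    -- The letter `x` does not recur in `l`, so the supremum bounding the tail is over an empty
    -- family.
    · have h₂ : (Exp.linearSum l t).series ρ (x :: w) = 0 := by
        refine le_antisymm ((ih hl.2).trans ?_) zero_le
        refine iSup₂_le fun T hT => absurd ?_ hl.1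
        exact List.mem_map.2 ⟨_, hT, hx⟩
      rw [h₂, if_pos hx, add_zero]
      exact le_iSup₂_of_le p.2 (by simp [hx]) le_rfl
    · rw [if_neg hx, zero_add]
      exact (ih hl.2).trans (iSup₂_le fun T hT => le_iSup₂_of_le T (List.mem_cons_of_mem _ hT) le_rfl)

theorem NonOverlapping.series_le {E : PMap A V} (hE : NonOverlapping E) {R : V} {α : Exp A V}
    (h : E R = some α) :
    α.series (fun S w => acceptance E w S) ≤ fun w => acceptance E w R := by
  obtain ⟨l, t, hl, ht, rfl⟩ := hE R α h
  intro w
  cases w with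
  | nil =>
    rw [series_linearSum_nil]
    rcases ht with rfl | rfl
    · have : acceptance E [] R = 1 := by
        rw [acceptance]
        exact if_pos ⟨l, h⟩
      exact this.ge
    · exact zero_le
  | cons x w =>
    refine (series_linearSum_cons_le _ ht hl x w).trans ?_
    simp only [acceptance]
    exact iSup₂_le fun T hT => le_iSup₂_of_le T ⟨l, t, h, hT⟩ le_rfl

/-! ### Solving -/

/-- Every equation and every entry of the substitution holds as an inequality under `ρ`, the
remaining symbols are those of the remaining equations, and each symbol of `D` has an equation or
an entry. -/
structure Presolved (D : Set V) (ρ : V → List A → ℕ∞) (c : PMap A V × PMap A V) : Prop where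
  defined : ∀ R ∈ D, R ∈ c.1.dom ∨ R ∈ c.2.dom
  equation_le : ∀ R α, c.2 R = some α → α.series ρ ≤ ρ R
  equation_closed : ∀ R α, c.2 R = some α → ∀ S, α.Occurs S → S ∈ c.2.dom
  entry_le : ∀ R α, c.1 R = some α → α.series ρ ≤ ρ R
  entry_closed : ∀ R α, c.1 R = some α → ∀ S, α.Occurs S → S ∈ c.2.dom

theorem PMap.mem_dom {E : PMap A V} {R : V} : R ∈ E.dom ↔ ∃ α, E R = some α :=
  Option.isSome_iff_exists

theorem Normalizes.exists_eqv {E E' : PMap A V} (h : Normalizes E E') {R : V} {α : Exp A V}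
    (hR : E' R = some α) : ∃ β, E R = some β ∧ Exp.Eqv β α := by
  have := h R
  rw [hR] at this
  generalize E R = o at this
  cases this with
  | some h => exact ⟨_, rfl, h⟩

theorem Normalizes.dom_eq {E E' : PMap A V} (h : Normalizes E E') : E'.dom = E.dom := by
  ext R
  have := h R
  simp only [PMap.dom, Set.mem_ofPred_eq]
  generalize E R = o at this
  generalize E' R = o' at this
  cases this <;> rfl

theorem Presolved.normalizes {D : Set V} {ρ : V → List A → ℕ∞} {ψ E E' : PMap A V}
    (h : Presolved D ρ (ψ, E)) (hE : Normalizes E E') : Presolved D ρ (ψ, E') where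
  defined R hR := by
    rw [hE.dom_eq]
    exact h.defined R hR
  equation_le R α hα := by
    obtain ⟨β, hβ, hβα⟩ := hE.exists_eqv hα
    rw [← hβα.series_eq]
    exact h.equation_le R β hβ
  equation_closed R α hα S hS := by
    obtain ⟨β, hβ, hβα⟩ := hE.exists_eqv hα
    rw [hE.dom_eq]
    exact h.equation_closed R β hβ S ((hβα.occurs_iff S).2 hS)
  entry_le := h.entry_le
  entry_closed R α hα S hS := by
    rw [hE.dom_eq]
    exact h.entry_closed R α hα S hS

theorem Presolved.arden [DecidableEq V] {D : Set V} {ρ : V → List A → ℕ∞} {ψ E : PMap A V} {R : V}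
    {s : RegularExpression A} {α : Exp A V} (h : Presolved D ρ (ψ, E))
    (hR : E R = some (.plus (.comp (Exp.ofRE s) (.var R)) α)) :
    Presolved D ρ (ψ, Function.update E R (some (.comp (.star (Exp.ofRE s)) α))) := by
  have hdom : PMap.dom (Function.update E R (some (.comp (.star (Exp.ofRE s)) α))) =
      E.dom := by
    ext S
    by_cases hS : S = R
    · subst hS
      simp [PMap.dom, hR]
    · simp [PMap.dom, hS]
  refine ⟨?_, ?_, ?_, h.entry_le, ?_⟩
  · simpa only [hdom] using h.defined
  · intro S β hβ
    by_cases hS : S = R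
    · subst hS
      simp only [Function.update_self, Option.some.injEq] at hβ
      subst hβ
      -- The old inequality says that `ρ S` is a presolution of `f · X + g ≤ X`, where `f` and `g`
      -- are the series of `s` and `α`.
      exact starSeries_conv_le (h.equation_le S _ hR)
    · simp only [Function.update_of_ne hS] at hβ
      exact h.equation_le S β hβ
  · intro S β hβ T hT
    simp only [hdom]
    by_cases hS : S = R
    · subst hS
      simp only [Function.update_self, Option.some.injEq] at hβ
      subst hβ
      exact h.equation_closed S _ hR T
        (Or.inr (hT.resolve_left (Exp.not_occurs_ofRE s T)))
    · simp only [Function.update_of_ne hS] at hβ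
      exact h.equation_closed S β hβ T hT
  · simpa only [hdom] using h.entry_closed

theorem Presolved.subst [DecidableEq V] {D : Set V} {ρ : V → List A → ℕ∞} {ψ E : PMap A V} {R : V}
    {α : Exp A V} (h : Presolved D ρ (ψ, E)) (hR : E R = some α) (hα : ¬ α.Occurs R) :
    Presolved D ρ (Function.update (fun S => (ψ S).map (Exp.replace R α)) R (some α),
      Function.update (fun S => (E S).map (Exp.replace R α)) R none) := by
  have hle := h.equation_le R α hR
  have hdom : ∀ S, S ∈ PMap.dom (Function.update (fun S => (E S).map (Exp.replace R α)) R none) ↔ S ∈ E.dom ∧ S ≠ R := by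
    intro S
    by_cases hS : S = R
    · subst hS
      simp [PMap.dom]
    · simp [PMap.dom, hS]
  -- As `R` does not occur in `α`, substitution really eliminates it: every symbol introduced still
  -- has an equation.
  have hclosed : ∀ S, α.Occurs S → S ∈ E.dom ∧ S ≠ R := fun S hS =>
    ⟨h.equation_closed R α hR S hS, fun e => hα (e ▸ hS)⟩
  refine ⟨?_, ?_, ?_, ?_, ?_⟩
  · intro S hS
    simp only [hdom]
    by_cases hSR : S = R
    · subst hSR
      simp [PMap.dom]
    · exact (h.defined S hS).imp (fun h => by simpa [PMap.dom, hSR] using h) (fun h => ⟨h, hSR⟩)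
  · intro S β hβ
    by_cases hS : S = R
    · subst hS
      simp at hβ
    · simp only [Function.update_of_ne hS, Option.map_eq_some_iff] at hβ
      obtain ⟨γ, hγ, rfl⟩ := hβ
      exact (Exp.series_replace_le hle γ).trans (h.equation_le S γ hγ)
  · intro S β hβ T hT
    simp only [hdom]
    by_cases hS : S = R
    · subst hS
      simp at hβ
    · simp only [Function.update_of_ne hS, Option.map_eq_some_iff] at hβ
      obtain ⟨γ, hγ, rfl⟩ := hβ
      exact hT.of_replace.elim (hclosed T) fun hT => ⟨h.equation_closed S γ hγ T hT.1, hT.2⟩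
  · intro S β hβ
    by_cases hS : S = R
    · subst hS
      simp only [Function.update_self, Option.some.injEq] at hβ
      exact hβ ▸ hle
    · simp only [Function.update_of_ne hS, Option.map_eq_some_iff] at hβ
      obtain ⟨γ, hγ, rfl⟩ := hβ
      exact (Exp.series_replace_le hle γ).trans (h.entry_le S γ hγ)
  · intro S β hβ T hT
    simp only [hdom]
    by_cases hS : S = R
    · subst hS
      simp only [Function.update_self, Option.some.injEq] at hβ
      exact hclosed T (hβ ▸ hT)
    · simp only [Function.update_of_ne hS, Option.map_eq_some_iff] at hβ
      obtain ⟨γ, hγ, rfl⟩ := hβ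
      exact hT.of_replace.elim (hclosed T) fun hT => ⟨h.entry_closed S γ hγ T hT.1, hT.2⟩

theorem Presolved.steps [DecidableEq V] {D : Set V} {ρ : V → List A → ℕ∞}
    {c c' : PMap A V × PMap A V} (h : Presolved D ρ c) (hc : Steps c c') : Presolved D ρ c' := by
  induction hc with
  | refl => exact h
  | tail _ hstep ih =>
    cases hstep with
    | arden ψ E R s α hR _ => exact ih.arden hR
    | subst ψ E E' R α hR hα hE' => exact (ih.subst hR hα).normalizes hE'

theorem presolved_initial {E : PMap A V} (hE : IsRegularEquations E) (hno : NonOverlapping E) :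
    Presolved E.dom (fun S w => acceptance E w S) (PMap.empty, E) where
  defined _ hR := Or.inr hR
  equation_le _ _ h := hno.series_le h
  equation_closed := hE.closed
  entry_le _ _ h := nomatch h
  entry_closed _ _ h := nomatch h

end RegEq

theorem mainTheorem2 {A : Type u} {V : Type v} [DecidableEq V]
    (E E₀ ψ : RegEq.PMap A V)
    (hE : RegEq.IsRegularEquations E) (hno : RegEq.NonOverlapping E)
    (hnorm : RegEq.Normalizes E E₀)
    (hsolve : RegEq.Steps (RegEq.PMap.empty, E₀) (ψ, RegEq.PMap.empty)) :
    ∀ R ∈ E.dom, ∃ r : RegularExpression A, ψ R = some (RegEq.Exp.ofRE r) ∧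
      ¬ RegEq.Ambiguous (RegEq.PMap.empty : RegEq.PMap A V) (RegEq.Exp.ofRE r) := by
  intro R hR
  have hfinal := ((RegEq.presolved_initial hE hno).normalizes hnorm).steps hsolve
  have hempty : ∀ S, S ∉ (RegEq.PMap.empty : RegEq.PMap A V).dom := fun _ h => nomatch h
  obtain ⟨γ, hγ⟩ := RegEq.PMap.mem_dom.1 ((hfinal.defined R hR).resolve_right (hempty R))
  obtain ⟨r, rfl⟩ := RegEq.Exp.exists_eq_ofRE fun S hS =>
    hempty S (hfinal.entry_closed R γ hγ S hS)
  exact ⟨r, hγ, RegEq.not_ambiguous_of_series_le_one fun w =>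
    (hfinal.entry_le R _ hγ w).trans (RegEq.acceptance_le_one E w R)⟩
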